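/- Let $\mathbb K\in\{\mathbb R,\mathbb C\}$, let $X$ be a compact Hausdorff space, let $E$ be a Banach space over $\mathbb K$, and let $L:X\to\mathcal L(E)$, $\lambda\mapsto L_\lambda$, be continuous for the operator norm, with every $L_\lambda$ a bounded Fredholm operator. Write $\Theta(G)=X\times G$ for the product bundle with fibre $G$, and $K(X)$ for the Grothendieck group of the monoid of isomorphism classes of finite-dimensional $\mathbb K$-vector bundles over $X$ under Whitney sum (so $K(X)$ is $KO(X)$ if $\mathbb K=\mathbb R$). For a finite-dimensional subbundle $\mathcal V\subset\Theta(E)$ that is transversal to the image of $L$, that is, $\operatorname{im}(L_\lambda)+\mathcal V_\lambda=E$ for all $\lambda\in X$, the spaces $E(L,\mathcal V)_\lambda=\{u\in E: L_\lambda u\in\mathcal V_\lambda\}$ form a finite-dimensional subbundle $E(L,\mathcal V)$ of $\Theta(E)$. The index bundle of $L$ is $$\operatorname{ind}(L)=[E(L,\mathcal V)]-[\mathcal V]\in K(X)$$ for any such $\mathcal V$. Then the following hold. 1. The element $[E(L,\mathcal V)]-[\mathcal V]$ is the same for all finite-dimensional subbundles $\mathcal V\subset \Theta(E)$ transversal to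 the image of $L$. 2. There exist a closed subspace $E_1\subset E$ of finite codimension with $\ker L_\lambda\cap E_1=\{0\}$ for all $\lambda\in X$, and a norm-continuous family $P:X\to\mathcal L(E)$ of projections, $P_\lambda^2=P_\lambda$, with $\operatorname{im}P_\lambda=L_\lambda(E_1)$ for all $\lambda\in X$. 3. For every choice of $E_1$ and $P$ as in 2, the subbundle $\mathcal W=\operatorname{im}(I-P)$ of $\Theta(E)$ is finite-dimensional and transversal to the image of $L$, the map $$E(L,\mathcal W)\to\Theta(E/E_1),\qquad (\lambda,u)\mapsto(\lambda,[u]),$$ is an isomorphism of vector bundles, and the index bundle of $L$ agrees with the classical (Atiyah–Jänich) one: $$\operatorname{ind}(L)=[\Theta(E/E_1)]-[\operatorname{im}(I-P)]\in K(X).$$ -/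

import Mathlib

namespace IndexBundle

open Topology

universe u v w

/-- The total space of a family of sets over `X`. -/
@[ext]
structure Total {X : Type u} (V : X → Type v) where
  base : X
  vec : V base

/-- A (finite-dimensional, real or complex) vector bundle over `X`: a family of vector spaces with a
topology on its total space for which the projection is continuous and every point of `X` has an
open neighbourhood `U` over which the total space is homeomorphic to `U × 𝕜ⁿ` by a fibrewise linear
homeomorphism over `U`. The rank `n` may depend on the point. -/
structure VectBundle (𝕜 : Type w) [RCLike 𝕜] (X : Type u) [TopologicalSpace X] where
  fiber : X → Type v
  [addCommGroup : ∀ x, AddCommGroup (fiber x)]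
  [module : ∀ x, Module 𝕜 (fiber x)]
  [topology : TopologicalSpace (Total fiber)]
  continuous_proj : Continuous (Total.base : Total fiber → X)
  locally_trivial : ∀ x₀ : X, ∃ (U : Set X) (n : ℕ) (φ : ∀ x : U, fiber x ≃ₗ[𝕜] (Fin n → 𝕜)),
    IsOpen U ∧ x₀ ∈ U ∧
    Continuous (fun p : {p : Total fiber // p.base ∈ U} => φ ⟨p.1.base, p.2⟩ p.1.vec) ∧
    Continuous (fun q : U × (Fin n → 𝕜) => (⟨q.1, (φ q.1).symm q.2⟩ : Total fiber))

attribute [instance] VectBundle.addCommGroup VectBundle.module VectBundle.topology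

namespace VectBundle

variable {𝕜 : Type w} [RCLike 𝕜] {X : Type u} [TopologicalSpace X]

/-- A bundle isomorphism: fibrewise linear and a homeomorphism of the total spaces over `X`. -/
structure Iso (A B : VectBundle.{u, v, w} 𝕜 X) where
  equiv : ∀ x, A.fiber x ≃ₗ[𝕜] B.fiber x
  continuous_toFun :
    Continuous (fun p : Total A.fiber => (⟨p.base, equiv p.base p.vec⟩ : Total B.fiber))
  continuous_invFun :
    Continuous (fun p : Total B.fiber => (⟨p.base, (equiv p.base).symm p.vec⟩ : Total A.fiber))

def Iso.refl (A : VectBundle.{u, v, w} 𝕜 X) : Iso A A where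
  equiv _ := LinearEquiv.refl 𝕜 _
  continuous_toFun := continuous_id
  continuous_invFun := continuous_id

def Iso.symm {A B : VectBundle.{u, v, w} 𝕜 X} (f : Iso A B) : Iso B A where
  equiv x := (f.equiv x).symm
  continuous_toFun := f.continuous_invFun
  continuous_invFun := f.continuous_toFun

def Iso.trans {A B C : VectBundle.{u, v, w} 𝕜 X} (f : Iso A B) (g : Iso B C) : Iso A C where
  equiv x := (f.equiv x).trans (g.equiv x)
  continuous_toFun := g.continuous_toFun.comp f.continuous_toFun
  continuous_invFun := f.continuous_invFun.comp g.continuous_invFun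

/-- The trivial bundle `Θ(G)` with total space `X × G`. -/
def trivialBundle (𝕜 : Type w) [RCLike 𝕜] (X : Type u) [TopologicalSpace X] (G : Type v)
    [AddCommGroup G] [Module 𝕜 G] [TopologicalSpace G] [IsTopologicalAddGroup G]
    [ContinuousSMul 𝕜 G] [T2Space G] [FiniteDimensional 𝕜 G] : VectBundle.{u, v, w} 𝕜 X where
  fiber _ := G
  topology := TopologicalSpace.induced (fun p => (p.base, p.vec)) (inferInstance : TopologicalSpace (X × G))
  continuous_proj := by
    let _ : TopologicalSpace (Total fun _ : X => G) :=
      TopologicalSpace.induced (fun p => (p.base, p.vec)) (inferInstance : TopologicalSpace (X × G))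
    have h0 : Continuous (fun p : Total (fun _ : X => G) => (p.base, p.vec)) :=
      continuous_induced_dom
    exact continuous_fst.comp h0
  locally_trivial x₀ := by
    let _ : TopologicalSpace (Total fun _ : X => G) :=
      TopologicalSpace.induced (fun p => (p.base, p.vec)) (inferInstance : TopologicalSpace (X × G))
    have h0 : Continuous (fun p : Total (fun _ : X => G) => (p.base, p.vec)) :=
      continuous_induced_dom
    let e : G ≃L[𝕜] (Fin (Module.finrank 𝕜 G) → 𝕜) := ContinuousLinearEquiv.ofFinrankEq (by simp)
    refine ⟨Set.univ, Module.finrank 𝕜 G, fun _ => e.toLinearEquiv, isOpen_univ, trivial, ?_, ?_⟩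
    · exact e.continuous.comp (continuous_snd.comp (h0.comp continuous_subtype_val))
    · refine continuous_induced_rng.2 ?_
      exact (continuous_subtype_val.comp continuous_fst).prodMk
        (e.symm.continuous.comp continuous_snd)

/-- The topology of the total space of a Whitney sum: that of the fibre product. -/
abbrev sumTopology (A B : VectBundle.{u, v, w} 𝕜 X) :
    TopologicalSpace (Total fun x => A.fiber x × B.fiber x) :=
  TopologicalSpace.induced
    (fun p => ((⟨p.base, p.vec.1⟩, ⟨p.base, p.vec.2⟩) : Total A.fiber × Total B.fiber))
    inferInstance

/-- The Whitney sum. -/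
def sum (A B : VectBundle.{u, v, w} 𝕜 X) : VectBundle.{u, v, w} 𝕜 X where
  fiber x := A.fiber x × B.fiber x
  topology := sumTopology A B
  continuous_proj := by
    let _ := sumTopology A B
    have h0 : Continuous (fun p : Total (fun x => A.fiber x × B.fiber x) =>
        ((⟨p.base, p.vec.1⟩, ⟨p.base, p.vec.2⟩) : Total A.fiber × Total B.fiber)) :=
      continuous_induced_dom
    exact A.continuous_proj.comp (continuous_fst.comp h0)
  locally_trivial x₀ := by
    let _ := sumTopology A B
    obtain ⟨U, n, φ, hU, hxU, h1, h2⟩ := A.locally_trivial x₀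
    obtain ⟨V, m, ψ, hV, hxV, h3, h4⟩ := B.locally_trivial x₀
    let e : ((Fin n → 𝕜) × (Fin m → 𝕜)) ≃L[𝕜] (Fin (n + m) → 𝕜) :=
      ContinuousLinearEquiv.ofFinrankEq (by simp)
    have h0 : Continuous (fun p : Total (fun x => A.fiber x × B.fiber x) =>
        ((⟨p.base, p.vec.1⟩, ⟨p.base, p.vec.2⟩) : Total A.fiber × Total B.fiber)) :=
      continuous_induced_dom
    refine ⟨U ∩ V, n + m,
      fun x => ((φ ⟨x.1, x.2.1⟩).prodCongr (ψ ⟨x.1, x.2.2⟩)).trans e.toLinearEquiv,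
      hU.inter hV, ⟨hxU, hxV⟩, ?_, ?_⟩
    · refine e.continuous.comp (Continuous.prodMk ?_ ?_)
      · exact h1.comp (Continuous.subtype_mk
          ((continuous_fst.comp h0).comp continuous_subtype_val) fun p => p.2.1)
      · exact h3.comp (Continuous.subtype_mk
          ((continuous_snd.comp h0).comp continuous_subtype_val) fun p => p.2.2)
    · refine continuous_induced_rng.2 (Continuous.prodMk ?_ ?_)
      · exact h2.comp (Continuous.prodMk
          (Continuous.subtype_mk (continuous_subtype_val.comp continuous_fst) fun q => q.1.2.1)
          (continuous_fst.comp (e.symm.continuous.comp continuous_snd)))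
      · exact h4.comp (Continuous.prodMk
          (Continuous.subtype_mk (continuous_subtype_val.comp continuous_fst) fun q => q.1.2.2)
          (continuous_snd.comp (e.symm.continuous.comp continuous_snd)))

theorem continuous_sum_fst (A B : VectBundle.{u, v, w} 𝕜 X) :
    Continuous (fun p : Total (sum A B).fiber => (⟨p.base, p.vec.1⟩ : Total A.fiber)) :=
  continuous_fst.comp (continuous_induced_dom (t := inferInstance) (f := fun p : Total (sum A B).fiber =>
    ((⟨p.base, p.vec.1⟩, ⟨p.base, p.vec.2⟩) : Total A.fiber × Total B.fiber)))

theorem continuous_sum_snd (A B : VectBundle.{u, v, w} 𝕜 X) :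
    Continuous (fun p : Total (sum A B).fiber => (⟨p.base, p.vec.2⟩ : Total B.fiber)) :=
  continuous_snd.comp (continuous_induced_dom (t := inferInstance) (f := fun p : Total (sum A B).fiber =>
    ((⟨p.base, p.vec.1⟩, ⟨p.base, p.vec.2⟩) : Total A.fiber × Total B.fiber)))

theorem continuous_sum_mk {Y : Type*} [TopologicalSpace Y] {A B : VectBundle.{u, v, w} 𝕜 X}
    {f : Y → Total (sum A B).fiber}
    (h1 : Continuous fun y => (⟨(f y).base, (f y).vec.1⟩ : Total A.fiber))
    (h2 : Continuous fun y => (⟨(f y).base, (f y).vec.2⟩ : Total B.fiber)) : Continuous f :=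
  continuous_induced_rng.2 (h1.prodMk h2)

def Iso.sumCongr {A A' B B' : VectBundle.{u, v, w} 𝕜 X} (f : Iso A A') (g : Iso B B') :
    Iso (sum A B) (sum A' B') where
  equiv x := (f.equiv x).prodCongr (g.equiv x)
  continuous_toFun := continuous_sum_mk
    (f.continuous_toFun.comp (continuous_sum_fst A B))
    (g.continuous_toFun.comp (continuous_sum_snd A B))
  continuous_invFun := continuous_sum_mk
    (f.continuous_invFun.comp (continuous_sum_fst A' B'))
    (g.continuous_invFun.comp (continuous_sum_snd A' B'))

def sumComm (A B : VectBundle.{u, v, w} 𝕜 X) : Iso (sum A B) (sum B A) where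
  equiv x := LinearEquiv.prodComm 𝕜 (A.fiber x) (B.fiber x)
  continuous_toFun := continuous_sum_mk (continuous_sum_snd A B) (continuous_sum_fst A B)
  continuous_invFun := continuous_sum_mk (continuous_sum_snd B A) (continuous_sum_fst B A)

def sumAssoc (A B C : VectBundle.{u, v, w} 𝕜 X) :
    Iso (sum (sum A B) C) (sum A (sum B C)) where
  equiv x := LinearEquiv.prodAssoc 𝕜 (A.fiber x) (B.fiber x) (C.fiber x)
  continuous_toFun := continuous_sum_mk
    ((continuous_sum_fst A B).comp (continuous_sum_fst _ C))
    (continuous_sum_mk ((continuous_sum_snd A B).comp (continuous_sum_fst _ C))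
      (continuous_sum_snd _ C))
  continuous_invFun := continuous_sum_mk
    (continuous_sum_mk (continuous_sum_fst A _)
      ((continuous_sum_fst B C).comp (continuous_sum_snd A _)))
    ((continuous_sum_snd B C).comp (continuous_sum_snd A _))

/-- The bundle of rank `0`. -/
def zeroBundle (𝕜 : Type w) [RCLike 𝕜] (X : Type u) [TopologicalSpace X] :
    VectBundle.{u, v, w} 𝕜 X :=
  trivialBundle 𝕜 X PUnit.{v + 1}

def sumZero (A : VectBundle.{u, v, w} 𝕜 X) : Iso (sum A (zeroBundle 𝕜 X)) A where
  equiv _ :=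
    { toFun := fun p => p.1
      invFun := fun a => (a, PUnit.unit)
      map_add' := fun _ _ => rfl
      map_smul' := fun _ _ => rfl
      left_inv := fun _ => rfl
      right_inv := fun _ => rfl }
  continuous_toFun := continuous_sum_fst A _
  continuous_invFun := continuous_sum_mk continuous_id
    (continuous_induced_rng.2 (A.continuous_proj.prodMk continuous_const))

/-- Isomorphism of vector bundles as an equivalence relation. -/
instance isoSetoid (𝕜 : Type w) [RCLike 𝕜] (X : Type u) [TopologicalSpace X] :
    Setoid (VectBundle.{u, v, w} 𝕜 X) where
  r A B := Nonempty (Iso A B)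
  iseqv := ⟨fun A => ⟨Iso.refl A⟩, fun ⟨f⟩ => ⟨f.symm⟩, fun ⟨f⟩ ⟨g⟩ => ⟨f.trans g⟩⟩

end VectBundle

open VectBundle

/-- Isomorphism classes of vector bundles over `X`. -/
def IsoClass (𝕜 : Type w) [RCLike 𝕜] (X : Type u) [TopologicalSpace X] : Type (max u (v + 1) w) :=
  Quotient (isoSetoid.{u, v, w} 𝕜 X)

instance (𝕜 : Type w) [RCLike 𝕜] (X : Type u) [TopologicalSpace X] :
    Zero (IsoClass.{u, v, w} 𝕜 X) :=
  ⟨Quotient.mk _ (zeroBundle 𝕜 X)⟩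

instance (𝕜 : Type w) [RCLike 𝕜] (X : Type u) [TopologicalSpace X] :
    Add (IsoClass.{u, v, w} 𝕜 X) :=
  ⟨Quotient.map₂ sum fun _ _ ⟨f⟩ _ _ ⟨g⟩ => ⟨f.sumCongr g⟩⟩

/-- The commutative monoid of isomorphism classes under Whitney sum. -/
instance (𝕜 : Type w) [RCLike 𝕜] (X : Type u) [TopologicalSpace X] :
    AddCommMonoid (IsoClass.{u, v, w} 𝕜 X) where
  add_assoc := by
    rintro ⟨a⟩ ⟨b⟩ ⟨c⟩
    exact Quotient.sound ⟨sumAssoc a b c⟩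
  add_comm := by
    rintro ⟨a⟩ ⟨b⟩
    exact Quotient.sound ⟨sumComm a b⟩
  add_zero := by
    rintro ⟨a⟩
    exact Quotient.sound ⟨sumZero a⟩
  zero_add := by
    rintro ⟨a⟩
    exact Quotient.sound ⟨(sumComm _ a).trans (sumZero a)⟩
  nsmul := nsmulRec

/-- The group `K(X)` (`KO(X)` if `𝕜 = ℝ`): the Grothendieck group of the monoid of isomorphism
classes of vector bundles over `X`. -/
abbrev KGroup (𝕜 : Type w) [RCLike 𝕜] (X : Type u) [TopologicalSpace X] :=
  Algebra.GrothendieckAddGroup (IsoClass.{u, v, w} 𝕜 X)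

/-- The class `[A] ∈ K(X)` of a vector bundle. -/
def kClass {𝕜 : Type w} [RCLike 𝕜] {X : Type u} [TopologicalSpace X]
    (A : VectBundle.{u, v, w} 𝕜 X) : KGroup.{u, v, w} 𝕜 X :=
  Algebra.GrothendieckAddGroup.of (Quotient.mk (isoSetoid 𝕜 X) A : IsoClass 𝕜 X)

/-- A finite-dimensional subbundle of the product bundle `Θ(F) = X × F`: a family of subspaces of
`F` that locally has a continuous frame. -/
structure FinSubbundle (𝕜 : Type w) [RCLike 𝕜] (X : Type u) [TopologicalSpace X] (F : Type v)
    [NormedAddCommGroup F] [NormedSpace 𝕜 F] where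
  fiber : X → Submodule 𝕜 F
  locally_framed : ∀ x₀ : X, ∃ (U : Set X) (n : ℕ) (s : Fin n → X → F),
    IsOpen U ∧ x₀ ∈ U ∧ (∀ i, ContinuousOn (s i) U) ∧
    ∀ x ∈ U, LinearIndependent 𝕜 (fun i => s i x) ∧
      Submodule.span 𝕜 (Set.range fun i => s i x) = fiber x

section

variable {𝕜 : Type w} [RCLike 𝕜] {X : Type u} [TopologicalSpace X] {E F : Type v}
  [NormedAddCommGroup E] [NormedSpace 𝕜 E] [NormedAddCommGroup F] [NormedSpace 𝕜 F]

/-- The linear map `𝕜ⁿ → F` with `eᵢ ↦ sᵢ`. -/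
def frameMap {n : ℕ} (s : Fin n → F) : (Fin n → 𝕜) →L[𝕜] F :=
  ∑ i, (ContinuousLinearMap.proj i : (Fin n → 𝕜) →L[𝕜] 𝕜).smulRight (s i)

theorem frameMap_apply {n : ℕ} (s : Fin n → F) (c : Fin n → 𝕜) :
    frameMap s c = ∑ i, c i • s i := by
  simp [frameMap]

theorem frameMap_continuousOn {n : ℕ} {s : Fin n → X → F} {U : Set X}
    (hs : ∀ i, ContinuousOn (s i) U) :
    ContinuousOn (fun x => (frameMap (fun i => s i x) : (Fin n → 𝕜) →L[𝕜] F)) U := by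
  unfold frameMap
  refine continuousOn_finsetSum _ fun i _ => ?_
  exact ((ContinuousLinearMap.smulRightL 𝕜 (Fin n → 𝕜) F
    (ContinuousLinearMap.proj i)).continuous.comp_continuousOn (hs i))

theorem frameMap_injective {n : ℕ} {s : Fin n → F} (hs : LinearIndependent 𝕜 s) :
    Function.Injective (frameMap s : (Fin n → 𝕜) →L[𝕜] F) := by
  rw [injective_iff_map_eq_zero]
  intro c hc
  rw [frameMap_apply] at hc
  exact funext (Fintype.linearIndependent_iff.1 hs c hc)

theorem frameMap_range {n : ℕ} (s : Fin n → F) :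
    (frameMap s : (Fin n → 𝕜) →L[𝕜] F).range = Submodule.span 𝕜 (Set.range s) := by
  ext y
  simp only [LinearMap.mem_range, ContinuousLinearMap.coe_coe, frameMap_apply,
    Submodule.mem_span_range_iff_exists_fun]

/-- Coordinates with respect to a continuous frame depend continuously on the vector. -/
theorem continuousAt_coord {Y : Type*} [TopologicalSpace Y] {n : ℕ}
    {S : Y → (Fin n → 𝕜) →L[𝕜] F} {c : Y → (Fin n → 𝕜)} {y₀ : Y} (hS : ContinuousAt S y₀)
    (hinj : Function.Injective (S y₀)) (h : ContinuousAt (fun y => S y (c y)) y₀) :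
    ContinuousAt c y₀ := by
  obtain ⟨r, hr⟩ : ∃ r : F →L[𝕜] (Fin n → 𝕜), ∀ c, r (S y₀ c) = c := by
    let e : (Fin n → 𝕜) ≃ₗ[𝕜] (S y₀).range :=
      LinearEquiv.ofInjective (S y₀ : (Fin n → 𝕜) →ₗ[𝕜] F) hinj
    obtain ⟨p, hp⟩ := Submodule.ClosedComplemented.of_finiteDimensional (S y₀).range
    refine ⟨(LinearMap.toContinuousLinearMap e.symm.toLinearMap).comp p, fun c => ?_⟩
    have : p (S y₀ c) = e c := hp (e c)
    simp [this]
  have hA : ContinuousAt (fun y => r.comp (S y)) y₀ :=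
    (((ContinuousLinearMap.compL 𝕜 (Fin n → 𝕜) F (Fin n → 𝕜)) r).continuous.continuousAt).comp hS
  have hA0 : r.comp (S y₀) = 1 := by
    ext1 c; simp [hr]
  have hinv : ContinuousAt (fun y => Ring.inverse (r.comp (S y))) y₀ := by
    have h1 := NormedRing.inverse_continuousAt (1 : ((Fin n → 𝕜) →L[𝕜] (Fin n → 𝕜))ˣ)
    refine ContinuousAt.comp (g := Ring.inverse) (f := fun y => r.comp (S y)) ?_ hA
    rw [hA0]
    exact h1
  have hu : ∀ᶠ y in 𝓝 y₀, IsUnit (r.comp (S y)) := by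
    refine hA.eventually (Units.isOpen.mem_nhds ?_)
    show IsUnit (r.comp (S y₀))
    rw [hA0]; exact isUnit_one
  have hfin : ContinuousAt (fun y => Ring.inverse (r.comp (S y)) (r (S y (c y)))) y₀ :=
    hinv.clm_apply (r.continuous.continuousAt.comp h)
  refine hfin.congr ?_
  filter_upwards [hu] with y hy
  have := Ring.inverse_mul_cancel _ hy
  exact congrArg (fun T : (Fin n → 𝕜) →L[𝕜] (Fin n → 𝕜) => T (c y)) this

/-- A finite-dimensional subbundle as a vector bundle; its total space is topologised as a subspace
of `X × F`. -/
def FinSubbundle.toVectBundle (V : FinSubbundle 𝕜 X F) : VectBundle.{u, v, w} 𝕜 X where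
  fiber x := V.fiber x
  topology := TopologicalSpace.induced (fun p => (p.base, (p.vec : F)))
    (inferInstance : TopologicalSpace (X × F))
  continuous_proj := by
    let _ : TopologicalSpace (Total fun x => V.fiber x) := TopologicalSpace.induced
      (fun p => (p.base, (p.vec : F))) (inferInstance : TopologicalSpace (X × F))
    have h0 : Continuous (fun p : Total (fun x => V.fiber x) => (p.base, (p.vec : F))) :=
      continuous_induced_dom
    exact continuous_fst.comp h0
  locally_trivial x₀ := by
    let _ : TopologicalSpace (Total fun x => V.fiber x) := TopologicalSpace.induced
      (fun p => (p.base, (p.vec : F))) (inferInstance : TopologicalSpace (X × F))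
    have h0 : Continuous (fun p : Total (fun x => V.fiber x) => (p.base, (p.vec : F))) :=
      continuous_induced_dom
    obtain ⟨U, n, s, hU, hx, hs, hsp⟩ := V.locally_framed x₀
    have hinj : ∀ x : U, Function.Injective (frameMap (fun i => s i x) : (Fin n → 𝕜) →L[𝕜] F) :=
      fun x => frameMap_injective (hsp x x.2).1
    have hran : ∀ x : U, (frameMap (fun i => s i x) : (Fin n → 𝕜) →L[𝕜] F).range = V.fiber x :=
      fun x => (frameMap_range _).trans (hsp x x.2).2
    let ψ : ∀ x : U, (Fin n → 𝕜) ≃ₗ[𝕜] V.fiber x := fun x =>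
      (LinearEquiv.ofInjective
        ((frameMap (fun i => s i x) : (Fin n → 𝕜) →L[𝕜] F) : (Fin n → 𝕜) →ₗ[𝕜] F) (hinj x)).trans
        (LinearEquiv.ofEq _ _ (hran x))
    have hψ : ∀ (x : U) c, ((ψ x c : V.fiber x) : F) = frameMap (fun i => s i x) c :=
      fun x c => rfl
    have hS : Continuous (fun x : U => (frameMap (fun i => s i x) : (Fin n → 𝕜) →L[𝕜] F)) :=
      continuousOn_iff_continuous_domRestrict.1 (frameMap_continuousOn hs)
    refine ⟨U, n, fun x => (ψ x).symm, hU, hx, ?_, ?_⟩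
    · rw [continuous_iff_continuousAt]
      intro p
      have hb : Continuous (fun p : {p : Total (fun x => V.fiber x) // p.base ∈ U} =>
          (⟨p.1.base, p.2⟩ : U)) :=
        Continuous.subtype_mk ((continuous_fst.comp h0).comp continuous_subtype_val) _
      refine continuousAt_coord (S := fun p : {p : Total (fun x => V.fiber x) // p.base ∈ U} =>
        (frameMap (fun i => s i p.1.base) : (Fin n → 𝕜) →L[𝕜] F))
        (hS.comp hb).continuousAt (hinj ⟨p.1.base, p.2⟩) ?_
      refine Continuous.continuousAt ?_
      have : (fun p : {p : Total (fun x => V.fiber x) // p.base ∈ U} =>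
          (frameMap (fun i => s i p.1.base) : (Fin n → 𝕜) →L[𝕜] F)
            ((ψ ⟨p.1.base, p.2⟩).symm p.1.vec)) = fun p => (p.1.vec : F) := by
        funext p
        rw [← hψ ⟨p.1.base, p.2⟩, LinearEquiv.apply_symm_apply]
      rw [this]
      exact (continuous_snd.comp h0).comp continuous_subtype_val
    · refine continuous_induced_rng.2 (Continuous.prodMk
        (continuous_subtype_val.comp continuous_fst) ?_)
      exact (hS.comp continuous_fst).clm_apply continuous_snd

/-- `V` is transversal to the image of `L`. -/
def IsTransversal (L : C(X, E →L[𝕜] F)) (V : FinSubbundle 𝕜 X F) : Prop :=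
  ∀ x, (L x).range ⊔ V.fiber x = ⊤

/-- The bundle `E(L, V)` with fibres `{u ∈ E : L_x u ∈ V_x}`, for a family of Fredholm operators
`L` and a finite-dimensional subbundle `V` of `Θ(F)` transversal to the image of `L`. -/
def preimageBundle [CompleteSpace E] [CompleteSpace F] (L : C(X, E →L[𝕜] F))
    (hL : ∀ x, (L x).IsFredholm) (V : FinSubbundle 𝕜 X F) (hV : IsTransversal L V) :
    FinSubbundle 𝕜 X E where
  fiber x := (V.fiber x).comap (L x : E →ₗ[𝕜] F)
  locally_framed x₀ := by
    obtain ⟨U, n, s, hU, hx, hs, hsp⟩ := V.locally_framed x₀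
    set N : Submodule 𝕜 E := (V.fiber x₀).comap (L x₀ : E →ₗ[𝕜] F) with hN
    have hVfin : FiniteDimensional 𝕜 (V.fiber x₀) := by
      rw [← (hsp x₀ hx).2]
      exact FiniteDimensional.span_of_finite 𝕜 (Set.finite_range _)
    have hNfin : FiniteDimensional 𝕜 N := by
      have hk := (hL x₀).finite_ker
      refine Module.Finite.iff_fg.2 (Submodule.fg_of_fg_map_of_fg_inf_ker (L x₀ : E →ₗ[𝕜] F) ?_ ?_)
      · have : FiniteDimensional 𝕜 (N.map (L x₀ : E →ₗ[𝕜] F)) :=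
          Submodule.finiteDimensional_of_le (Submodule.map_comap_le _ _)
        exact Module.Finite.iff_fg.1 this
      · have : FiniteDimensional 𝕜 (N ⊓ (L x₀).ker : Submodule 𝕜 E) :=
          Submodule.finiteDimensional_of_le inf_le_right
        exact Module.Finite.iff_fg.1 this
    obtain ⟨M, hMcl, hNM⟩ :=
      (Submodule.ClosedComplemented.of_finiteDimensional N).exists_isClosed_isCompl
    have : CompleteSpace M := hMcl.completeSpace_coe
    let B : X → (M × (Fin n → 𝕜)) →L[𝕜] F := fun x =>
      ((L x).comp M.subtypeL).coprod (frameMap fun i => s i x)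
    have hBapp : ∀ x m c, B x (m, c) = L x m + frameMap (fun i => s i x) c := fun x m c => by
      simp [B]
    have hSV : ∀ x ∈ U, ∀ c : Fin n → 𝕜, frameMap (fun i => s i x) c ∈ V.fiber x := by
      intro x hxU c
      rw [← (hsp x hxU).2, ← frameMap_range]
      exact ⟨c, rfl⟩
    have hSV' : ∀ x ∈ U, ∀ y ∈ V.fiber x, ∃ c : Fin n → 𝕜, frameMap (fun i => s i x) c = y := by
      intro x hxU y hy
      rw [← (hsp x hxU).2, ← frameMap_range] at hy
      exact hy
    have hBc : ContinuousOn B U := by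
      have h1 : Continuous fun x => (L x).comp M.subtypeL :=
        ((ContinuousLinearMap.compL 𝕜 M E F).flip M.subtypeL).continuous.comp L.continuous
      have h2 := frameMap_continuousOn (𝕜 := 𝕜) hs
      have h3 : B = fun x => ((L x).comp M.subtypeL).comp (ContinuousLinearMap.fst 𝕜 M (Fin n → 𝕜))
          + (frameMap fun i => s i x).comp (ContinuousLinearMap.snd 𝕜 M (Fin n → 𝕜)) := by
        funext x
        apply ContinuousLinearMap.ext
        intro p
        simp [B]
      rw [h3]
      refine ContinuousOn.add ?_ ?_
      · exact (((ContinuousLinearMap.compL 𝕜 (M × (Fin n → 𝕜)) M F).flip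
          (ContinuousLinearMap.fst 𝕜 M (Fin n → 𝕜))).continuous.comp h1).continuousOn
      · exact ((ContinuousLinearMap.compL 𝕜 (M × (Fin n → 𝕜)) (Fin n → 𝕜) F).flip
          (ContinuousLinearMap.snd 𝕜 M (Fin n → 𝕜))).continuous.comp_continuousOn h2
    have hB0 : B x₀ ∈ Set.range ((↑) : ((M × (Fin n → 𝕜)) ≃L[𝕜] F) → _ →L[𝕜] F) := by
      refine ⟨ContinuousLinearEquiv.ofBijective (B x₀) ?_ ?_,
        ContinuousLinearEquiv.coe_ofBijective _ _ _⟩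
      · rw [LinearMap.ker_eq_bot']
        rintro ⟨m, c⟩ hmc
        have hmc' : L x₀ m + frameMap (fun i => s i x₀) c = 0 := by
          rw [← hBapp]; exact hmc
        have hmN : (m : E) ∈ N := by
          show L x₀ m ∈ V.fiber x₀
          rw [eq_neg_of_add_eq_zero_left hmc']
          exact neg_mem (hSV x₀ hx c)
        have hm : (m : E) = 0 := by
          have : (m : E) ∈ N ⊓ M := ⟨hmN, m.2⟩
          rwa [hNM.inf_eq_bot] at this
        rw [hm, map_zero, zero_add] at hmc'
        have hc : c = 0 := frameMap_injective (hsp x₀ hx).1 (by rw [hmc', map_zero])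
        rw [hc, Subtype.ext (a1 := m) (a2 := 0) hm]
        rfl
      · rw [LinearMap.range_eq_top]
        intro y
        have hy : y ∈ (L x₀).range ⊔ V.fiber x₀ := by rw [hV x₀]; trivial
        obtain ⟨_, ⟨a, rfl⟩, b, hb, rfl⟩ := Submodule.mem_sup.1 hy
        have ha : a ∈ N ⊔ M := by rw [hNM.sup_eq_top]; trivial
        obtain ⟨k, hk, m, hm, rfl⟩ := Submodule.mem_sup.1 ha
        obtain ⟨c, hc⟩ := hSV' x₀ hx (L x₀ k + b) (add_mem hk hb)
        refine ⟨(⟨m, hm⟩, c), ?_⟩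
        show B x₀ (⟨m, hm⟩, c) = L x₀ (k + m) + b
        rw [hBapp, hc, map_add]
        simp only
        abel
    let b := Module.finBasis 𝕜 N
    let t : X → N →ₗ[𝕜] E := fun x =>
      N.subtype - M.subtype ∘ₗ LinearMap.fst 𝕜 M (Fin n → 𝕜) ∘ₗ
        ((B x).inverse : F →ₗ[𝕜] (M × (Fin n → 𝕜))) ∘ₗ (L x : E →ₗ[𝕜] F) ∘ₗ N.subtype
    have htapp : ∀ x k, t x k = (k : E) - (((B x).inverse (L x k)).1 : E) := fun _ _ => rfl
    let O : Set X := U ∩ B ⁻¹' (Set.range ((↑) : ((M × (Fin n → 𝕜)) ≃L[𝕜] F) → _ →L[𝕜] F))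
    refine ⟨O, Module.finrank 𝕜 N, fun i x => t x (b i),
      hBc.isOpen_inter_preimage hU ContinuousLinearEquiv.isOpen, ⟨hx, hB0⟩, ?_, ?_⟩
    · rintro i x ⟨hxU, e, he⟩
      have hBx : ContinuousAt B x := hBc.continuousAt (hU.mem_nhds hxU)
      have hinv : ContinuousAt (fun y => (B y).inverse) x := by
        have h1 := (ContinuousLinearMap.IsInvertible.contDiffAt_map_inverse (𝕜 := 𝕜) (n := 0)
          (e := B x) ⟨e, he⟩).continuousAt
        exact ContinuousAt.comp (g := ContinuousLinearMap.inverse) (f := B) h1 hBx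
      have h2 : ContinuousAt (fun y => (B y).inverse (L y (b i))) x :=
        hinv.clm_apply (L.continuous.continuousAt.clm_apply continuousAt_const)
      refine ContinuousAt.continuousWithinAt ?_
      exact continuousAt_const.sub
        (continuous_subtype_val.continuousAt.comp (continuous_fst.continuousAt.comp h2))
    · rintro x ⟨hxU, e, he⟩
      have hBinv : (B x).IsInvertible := ⟨e, he⟩
      have htinj : LinearMap.ker (t x) = ⊥ := by
        rw [LinearMap.ker_eq_bot']
        intro k hk
        rw [htapp, sub_eq_zero] at hk
        have : (k : E) ∈ N ⊓ M := ⟨k.2, hk ▸ Subtype.prop _⟩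
        rw [hNM.inf_eq_bot] at this
        exact Subtype.ext this
      have htran : LinearMap.range (t x) = (V.fiber x).comap (L x : E →ₗ[𝕜] F) := by
        ext a
        constructor
        · rintro ⟨k, rfl⟩
          show L x (t x k) ∈ V.fiber x
          have h1 := hBinv.self_apply_inverse (L x k)
          have h2 := hBapp x ((B x).inverse (L x k)).1 ((B x).inverse (L x k)).2
          rw [Prod.mk.eta, h1] at h2
          rw [htapp, map_sub]
          nth_rw 1 [h2]
          rw [add_sub_cancel_left]
          exact hSV x hxU _
        · intro ha
          have ha' : a ∈ N ⊔ M := by rw [hNM.sup_eq_top]; trivial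
          obtain ⟨k, hk, m, hm, rfl⟩ := Submodule.mem_sup.1 ha'
          obtain ⟨c, hc⟩ := hSV' x hxU _ ha
          refine ⟨⟨k, hk⟩, ?_⟩
          have h1 : L x k = B x (-⟨m, hm⟩, c) := by
            rw [hBapp, hc]
            simp
          rw [htapp]
          simp only
          rw [h1, hBinv.inverse_apply_self]
          simp
      refine ⟨b.linearIndependent.map' (t x) htinj, ?_⟩
      have : (Set.range fun i => t x (b i)) = t x '' Set.range b := by
        rw [← Set.range_comp]; rfl
      rw [this, ← Submodule.map_span, b.span_eq, Submodule.map_top, htran]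

open Classical in
/-- The index bundle `ind L = [E(L, V)] - [V] ∈ K(X)` of a norm-continuous family of Fredholm
operators, formed with any finite-dimensional subbundle `V` transversal to the image of `L`. -/
noncomputable def indexBundle [CompleteSpace E] [CompleteSpace F] (L : C(X, E →L[𝕜] F))
    (hL : ∀ x, (L x).IsFredholm) : KGroup.{u, v, w} 𝕜 X :=
  if h : ∃ V : FinSubbundle 𝕜 X F, IsTransversal L V then
    kClass (preimageBundle L hL h.choose h.choose_spec).toVectBundle
      - kClass h.choose.toVectBundle
  else 0

/-- The image of a continuous family of projections of finite rank is a subbundle. -/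
def rangeBundle (Q : C(X, E →L[𝕜] E)) (hQ : ∀ x, Q x ∘L Q x = Q x)
    (hfin : ∀ x, FiniteDimensional 𝕜 (Q x).range) [CompleteSpace E] : FinSubbundle 𝕜 X E where
  fiber x := (Q x).range
  locally_framed x₀ := by
    have hfix : ∀ x, ∀ a, Q x (Q x a) = Q x a := fun x a =>
      congrArg (fun T : E →L[𝕜] E => T a) (hQ x)
    have := hfin x₀
    let b := Module.finBasis 𝕜 (Q x₀).range
    let T : X → E →L[𝕜] E := fun x => Q x * Q x₀ + (1 - Q x) * (1 - Q x₀)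
    have hTapp : ∀ x a, T x a = Q x (Q x₀ a) + ((a - Q x₀ a) - Q x (a - Q x₀ a)) :=
      fun _ _ => rfl
    have hT : Continuous T := by
      have := Q.continuous
      fun_prop
    have hT0 : T x₀ = 1 := by
      ext1 a
      simp [hTapp, hfix]
    have hQT : ∀ x a, Q x (T x a) = T x (Q x₀ a) := by
      intro x a
      simp [hTapp, hfix]
    refine ⟨T ⁻¹' {A | IsUnit A}, Module.finrank 𝕜 (Q x₀).range, fun i x => Q x (b i),
      Units.isOpen.preimage hT, ?_, ?_, ?_⟩
    · show IsUnit (T x₀)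
      rw [hT0]; exact isUnit_one
    · intro i
      exact (Q.continuous.clm_apply continuous_const).continuousOn
    · rintro x ⟨A, hA⟩
      have hbi : ∀ k : (Q x₀).range, Q x₀ (k : E) = k := by
        rintro ⟨_, a, rfl⟩
        exact hfix x₀ a
      have hTk : ∀ k : (Q x₀).range, T x (k : E) = Q x (k : E) := by
        intro k
        rw [hTapp, hbi]
        simp
      have hAinv : ∀ a, (↑A⁻¹ : E →L[𝕜] E) (T x a) = a := by
        intro a
        rw [← hA]
        exact congrArg (fun S : E →L[𝕜] E => S a) A.inv_mul
      have hAinv' : ∀ a, T x ((↑A⁻¹ : E →L[𝕜] E) a) = a := by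
        intro a
        rw [← hA]
        exact congrArg (fun S : E →L[𝕜] E => S a) A.mul_inv
      let t : (Q x₀).range →ₗ[𝕜] E := (Q x : E →ₗ[𝕜] E) ∘ₗ (Q x₀).range.subtype
      have htinj : LinearMap.ker t = ⊥ := by
        rw [LinearMap.ker_eq_bot']
        intro k hk
        have hk' : T x (k : E) = 0 := (hTk k).trans hk
        have := hAinv (k : E)
        rw [hk', map_zero] at this
        exact Subtype.ext this.symm
      have htran : LinearMap.range t = (Q x).range := by
        apply le_antisymm
        · rintro _ ⟨k, rfl⟩
          exact ⟨k, rfl⟩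
        · rintro _ ⟨a, rfl⟩
          let a' := (↑A⁻¹ : E →L[𝕜] E) a
          refine ⟨⟨Q x₀ a', a', rfl⟩, ?_⟩
          have h1 := hTk ⟨Q x₀ a', a', rfl⟩
          have h2 := hQT x a'
          rw [hAinv'] at h2
          show Q x (Q x₀ a') = Q x a
          rw [h2]
          exact h1.symm
      refine ⟨b.linearIndependent.map' t htinj, ?_⟩
      have : (Set.range fun i => Q x (b i)) = t '' Set.range b := by
        rw [← Set.range_comp]; rfl
      rw [this, ← Submodule.map_span, b.span_eq, Submodule.map_top, htran]

/-- The choices in the classical construction of the index bundle of a family of Fredholm operators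
on a fixed Banach space: a closed subspace `E₁` of finite codimension that meets every kernel
trivially, and a norm-continuous family of projections `P` with `im P_x = L_x(E₁)`. -/
structure ClassicalData (L : C(X, E →L[𝕜] E)) where
  E₁ : Submodule 𝕜 E
  isClosed : IsClosed (E₁ : Set E)
  finite_codim : FiniteDimensional 𝕜 (E ⧸ E₁)
  ker_inf : ∀ x, (L x).ker ⊓ E₁ = ⊥
  P : C(X, E →L[𝕜] E)
  idem : ∀ x, P x ∘L P x = P x
  range_eq : ∀ x, (P x).range = E₁.map (L x : E →ₗ[𝕜] E)

namespace ClassicalData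

variable {L : C(X, E →L[𝕜] E)}

theorem finite_range_one_sub (D : ClassicalData L) (hL : ∀ x, (L x).IsFredholm) (x : X) :
    FiniteDimensional 𝕜 (1 - D.P x).range := by
  obtain ⟨C, hC⟩ := (L x).range.exists_isCompl
  obtain ⟨G, hG⟩ := D.E₁.exists_isCompl
  have := D.finite_codim
  have : FiniteDimensional 𝕜 G :=
    Module.Finite.equiv (Submodule.quotientEquivOfIsCompl D.E₁ G hG)
  have : FiniteDimensional 𝕜 C := .of_fg ((hL x).finite_coker.fg_of_isCompl hC)
  let R : Submodule 𝕜 E := G.map (L x : E →ₗ[𝕜] E) ⊔ C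
  have hP : ∀ u ∈ D.E₁, D.P x (L x u) = L x u := by
    intro u hu
    have h1 : L x u ∈ (D.P x).range := by
      rw [D.range_eq]
      exact ⟨u, hu, rfl⟩
    obtain ⟨a, ha⟩ := h1
    have h2 : D.P x a = L x u := ha
    rw [← h2]
    exact congrArg (fun T : E →L[𝕜] E => T a) (D.idem x)
  have hle : (1 - D.P x).range ≤ R.map ((1 - D.P x : E →L[𝕜] E) : E →ₗ[𝕜] E) := by
    rintro _ ⟨a, rfl⟩
    have ha : a ∈ (L x).range ⊔ C := by rw [hC.sup_eq_top]; trivial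
    obtain ⟨_, ⟨u, rfl⟩, c, hc, rfl⟩ := Submodule.mem_sup.1 ha
    have hu : u ∈ D.E₁ ⊔ G := by rw [hG.sup_eq_top]; trivial
    obtain ⟨u₁, hu₁, g, hg, rfl⟩ := Submodule.mem_sup.1 hu
    refine ⟨L x g + c, Submodule.add_mem_sup ⟨g, hg, rfl⟩ hc, ?_⟩
    have := hP u₁ hu₁
    simp [this]
    abel
  exact Submodule.finiteDimensional_of_le hle

/-- The subbundle `W = im (I - P)` of `Θ(E)`. -/
def W [CompleteSpace E] (D : ClassicalData L) (hL : ∀ x, (L x).IsFredholm) : FinSubbundle 𝕜 X E :=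
  rangeBundle (1 - D.P)
    (fun x => by
      ext1 a
      have := congrArg (fun T : E →L[𝕜] E => T a) (D.idem x)
      simp only [ContinuousLinearMap.comp_apply] at this
      simp [this])
    (D.finite_range_one_sub hL)

/-- The product bundle `Θ(E/E₁)`. -/
def quotientBundle (D : ClassicalData L) : VectBundle.{u, v, w} 𝕜 X :=
  haveI := D.isClosed
  haveI := D.finite_codim
  trivialBundle 𝕜 X (E ⧸ D.E₁)

/-- The classical index bundle `[Θ(E/E₁)] - [im (I - P)]`. -/
noncomputable def index [CompleteSpace E] (D : ClassicalData L) (hL : ∀ x, (L x).IsFredholm) :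
    KGroup.{u, v, w} 𝕜 X :=
  kClass D.quotientBundle - kClass (D.W hL).toVectBundle

end ClassicalData

end

end IndexBundle

/-! Two continuous families of partial inverses of `L` carry the proof. Each is built near a point
from a Fredholm decomposition and the openness of invertibility. The conditions imposed on it are
affine in the unknown operator, so partitions of unity over the compact Hausdorff space `X` glue the
local solutions (`exists_continuous_section_of_local`).

For transversal `V`, there is a family `R` with `L R = 1` modulo `V` (`exists_rightInverse_mod`).
Given two transversal subbundles, consider triples `(w, a, b)` with `L w = a + b`, `a ∈ V₁`, `b ∈
V₂`. Subtracting `R₁ b` from `w` identifies them with `E(L, V₁) ⊕ V₂`, and subtracting `R₂ a` with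
`E(L, V₂) ⊕ V₁`. These sums are therefore isomorphic, which gives independence of `V` in `K(X)`. The
fibrewise sum `V₁ + V₂`, whose rank may jump, is never used as a bundle.

On a closed subspace `M` of finite codimension, `L` has a continuous left inverse `A` with values in
`M` (`exists_leftInverse`). Then `P = L A` is a projection onto `L(M)`, so `M` and `P` are classical
data.

For arbitrary classical data, `E(L, W) = ker (P L)`. Since `P L` agrees on `E₁` with the injective
map `L`, whose image there is that of `P`, this kernel is a complement of `E₁`. Hence `E(L, W) ≅
Θ(E/E₁)`, and evaluating the index with `V = W` gives the classical formula. -/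

namespace IndexBundle

open Topology VectBundle

universe u v w

/-! ### Gluing affine conditions and inverting operators near the identity -/

section Selections

variable {𝕜 : Type w} [RCLike 𝕜] {X : Type u} [TopologicalSpace X]

/-- A family of affine subspaces of a normed space that locally has continuous sections has a
global continuous section. -/
theorem exists_continuous_section_of_local [CompactSpace X] [T2Space X] {G : Type*}
    [NormedAddCommGroup G] [NormedSpace 𝕜 G] (t : X → Set G)
    (ht : ∀ x, ∀ a ∈ t x, ∀ b ∈ t x, ∀ c d : 𝕜, c + d = 1 → c • a + d • b ∈ t x)
    (H : ∀ x : X, ∃ U ∈ 𝓝 x, ∃ g : X → G, ContinuousOn g U ∧ ∀ y ∈ U, g y ∈ t y) :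
    ∃ g : C(X, G), ∀ x, g x ∈ t x := by
  -- Partitions of unity produce real convex combinations, which are special cases of the `𝕜`-affine
  -- combinations in `ht`.
  let _ : NormedSpace ℝ G := NormedSpace.restrictScalars ℝ 𝕜 G
  refine exists_continuous_forall_mem_convex_of_local (fun x => ?_) H
  intro a ha b hb c d _ _ hcd
  have := ht x a ha b hb (c : 𝕜) (d : 𝕜) (by exact_mod_cast hcd)
  have hs : ∀ (r : ℝ) (y : G), r • y = (r : 𝕜) • y := fun r y =>
    RCLike.real_smul_eq_coe_smul (K := 𝕜) r y
  rw [hs, hs]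
  exact this

/-- A continuous family of operators that is the identity at `x₀` is invertible near `x₀`, with
continuous inverse. -/
theorem exists_nhds_ringInverse {R : Type*} [NormedRing R] [HasSummableGeomSeries R] {T : X → R}
    {V : Set X} {x₀ : X} (hV : V ∈ 𝓝 x₀) (hT : ContinuousOn T V) (h₀ : T x₀ = 1) :
    ∃ U ∈ 𝓝 x₀, U ⊆ V ∧ ContinuousOn (fun x => Ring.inverse (T x)) U ∧ ∀ x ∈ U, IsUnit (T x) := by
  have hu : ∀ᶠ x in 𝓝 x₀, IsUnit (T x) := by
    refine (hT.continuousAt hV).eventually (Units.isOpen.mem_nhds ?_)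
    show IsUnit (T x₀)
    rw [h₀]
    exact isUnit_one
  refine ⟨V ∩ {x | IsUnit (T x)}, Filter.inter_mem hV hu, Set.inter_subset_left, ?_,
    fun x hx => hx.2⟩
  rintro x ⟨hx, e, he⟩
  have h1 := NormedRing.inverse_continuousAt e
  rw [he] at h1
  exact ContinuousAt.comp_continuousWithinAt (g := Ring.inverse) h1
    ((hT x hx).mono Set.inter_subset_left)

end Selections

/-! ### Continuous left and right inverses up to finite dimension -/

section Parametrices

variable {𝕜 : Type w} [RCLike 𝕜] {X : Type u} [TopologicalSpace X] {E F : Type v}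
  [NormedAddCommGroup E] [NormedSpace 𝕜 E]
  [NormedAddCommGroup F] [NormedSpace 𝕜 F]

/-- Near each point, a family of Fredholm operators has a continuous left inverse on a closed
subspace of finite codimension. -/
theorem exists_local_leftInverse [CompleteSpace E] (L : C(X, E →L[𝕜] F))
    (hL : ∀ x, (L x).IsFredholm) (x₀ : X) :
    ∃ M : Submodule 𝕜 E, IsClosed (M : Set E) ∧ M.CoFG ∧ ∃ U ∈ 𝓝 x₀, ∃ A : X → F →L[𝕜] E,
      ContinuousOn A U ∧ ∀ x ∈ U, ∀ u ∈ M, A x (L x u) = u := by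
  obtain ⟨pkg⟩ := (hL x₀).nonempty_fredholmPackage
  set M := pkg.decDom.X₁ with hM
  have hMcl : IsClosed (M : Set E) := pkg.decDom.isTopCompl.isClosed
  have : CompleteSpace M := hMcl.completeSpace_coe
  have hfin := pkg.decDom.finite_X₀
  -- `A₀` inverts `L x₀` on `M`, a closed complement of its kernel. Freezing it while `x` varies
  -- gives endomorphisms `T x` of the fixed space `M`, with `T x₀ = 1`.
  let A₀ : F →L[𝕜] M := pkg.equiv.symm ∘L pkg.decCodom.proj
  let T : X → M →L[𝕜] M := fun x => A₀ ∘L L x ∘L M.subtypeL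
  have hT : Continuous T := by
    have := L.continuous
    fun_prop
  have hT₀ : T x₀ = 1 := by
    ext u
    have h1 : L x₀ (u : E) = (pkg.equiv u : F) := by
      conv_lhs => rw [pkg.eq_equiv]
      simp
    simp [T, A₀, h1]
  obtain ⟨U, hU, -, hc, hu⟩ :=
    exists_nhds_ringInverse Filter.univ_mem hT.continuousOn hT₀
  -- For `u ∈ M` one has `A₀ (L x u) = T x u`, so correcting `A₀` by the inverse of `T x` gives a
  -- left inverse on `M`.
  refine ⟨M, hMcl, (Module.Finite.iff_fg.1 hfin).cofg_of_isCompl pkg.decDom.isTopCompl.isCompl.symm,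
    U, hU, fun x => M.subtypeL ∘L Ring.inverse (T x) ∘L A₀, by fun_prop, ?_⟩
  intro x hx u huM
  have := congrArg (fun S : M →L[𝕜] M => ((S ⟨u, huM⟩ : M) : E))
    (Ring.inverse_mul_cancel _ (hu x hx))
  exact this

/-- A family of Fredholm operators over a compact space is uniformly injective on a closed subspace
of finite codimension, with a continuous left inverse taking values there. -/
theorem exists_leftInverse [CompactSpace X] [T2Space X] [CompleteSpace E]
    (L : C(X, E →L[𝕜] F)) (hL : ∀ x, (L x).IsFredholm) :
    ∃ M : Submodule 𝕜 E, IsClosed (M : Set E) ∧ M.CoFG ∧ ∃ A : C(X, F →L[𝕜] E),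
      (∀ x y, A x y ∈ M) ∧ ∀ x, ∀ u ∈ M, A x (L x u) = u := by
  choose M hMcl hMfin U hU A hA hAL using exists_local_leftInverse L hL
  obtain ⟨s, hs⟩ := CompactSpace.elim_nhds_subcover (fun x => interior (U x))
    fun x => interior_mem_nhds.2 (hU x)
  -- A finite intersection keeps both closedness and finite codimension, and every local left
  -- inverse of the subcover still works on it.
  let N : Submodule 𝕜 E := sInf (M '' s)
  have hNM : ∀ x ∈ s, N ≤ M x := fun x hx => sInf_le ⟨x, hx, rfl⟩
  have hNcl : IsClosed (N : Set E) := by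
    simp only [N, Submodule.coe_sInf]
    refine isClosed_biInter ?_
    rintro _ ⟨x, -, rfl⟩
    exact hMcl x
  have hNfin : N.CoFG := by
    refine Submodule.CoFG.sInf_of_finite (s.finite_toSet.image M) ?_
    rintro _ ⟨x, -, rfl⟩
    exact hMfin x
  obtain ⟨p, hp⟩ := Submodule.ClosedComplemented.of_finiteDimensional_quotient hNcl
  refine ⟨N, hNcl, hNfin, ?_⟩
  -- Both conditions are affine in `B`. Requiring values in `N` is what later makes the image of `L
  -- B` equal to `L(N)`.
  obtain ⟨B, hB⟩ := exists_continuous_section_of_local (𝕜 := 𝕜)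
    (fun x => {B : F →L[𝕜] E | (∀ y, B y ∈ N) ∧ ∀ u ∈ N, B (L x u) = u})
    (by
      rintro x a ⟨ha, ha'⟩ b ⟨hb, hb'⟩ c d hcd
      refine ⟨fun y => N.add_mem (N.smul_mem _ (ha y)) (N.smul_mem _ (hb y)), fun u hu => ?_⟩
      simp [ha' u hu, hb' u hu, ← add_smul, hcd])
    (by
      intro x
      have hx : x ∈ ⋃ y ∈ s, interior (U y) := hs ▸ Set.mem_univ x
      obtain ⟨y, hy, hxy⟩ := Set.mem_iUnion₂.1 hx
      -- Composing with the projection `p` onto `N` forces values in `N` without disturbing the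
      -- identity `A (L u) = u` for `u ∈ N`.
      refine ⟨U y, mem_interior_iff_mem_nhds.1 hxy, fun z => N.subtypeL ∘L p ∘L A y z,
        by have := hA y; fun_prop, fun z hz => ⟨fun a => (p (A y z a)).2, fun u hu => ?_⟩⟩
      show ((p (A y z (L z u)) : N) : E) = u
      rw [hAL y z hz u (hNM y hy hu)]
      exact congrArg Subtype.val (hp ⟨u, hu⟩))
  exact ⟨B, fun x => (hB x).1, fun x => (hB x).2⟩

/-- Near each point, a family of Fredholm operators has a continuous right inverse modulo a
transversal subbundle. -/
theorem exists_local_rightInverse_mod [CompleteSpace F] (L : C(X, E →L[𝕜] F))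
    (hL : ∀ x, (L x).IsFredholm) (V : FinSubbundle 𝕜 X F) (hV : IsTransversal L V)
    (x₀ : X) :
    ∃ U ∈ 𝓝 x₀, ∃ R : X → F →L[𝕜] E,
      ContinuousOn R U ∧ ∀ x ∈ U, ∀ y, L x (R x y) - y ∈ V.fiber x := by
  obtain ⟨pkg⟩ := (hL x₀).nonempty_fredholmPackage
  obtain ⟨O, n, s, hO, hx, hs, hsp⟩ := V.locally_framed x₀
  have := pkg.decCodom.finite_X₀
  have hran : ∀ x ∈ O, (frameMap (fun i => s i x) : (Fin n → 𝕜) →L[𝕜] F).range = V.fiber x :=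
    fun x hx => (frameMap_range _).trans (hsp x hx).2
  -- Adjoining a frame of `V` to `L` turns transversality at `x₀` into surjectivity of one operator
  -- from a fixed space.
  let S : X → (E × (Fin n → 𝕜)) →L[𝕜] F := fun x =>
    L x ∘L ContinuousLinearMap.fst 𝕜 E (Fin n → 𝕜) +
      frameMap (fun i => s i x) ∘L ContinuousLinearMap.snd 𝕜 E (Fin n → 𝕜)
  have hS : ContinuousOn S O := by
    have h1 := frameMap_continuousOn (𝕜 := 𝕜) hs
    have h2 := L.continuous
    fun_prop
  have hSurj : LinearMap.range (S x₀ : (E × (Fin n → 𝕜)) →ₗ[𝕜] F) = ⊤ := by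
    rw [eq_top_iff, ← hV x₀, ← hran x₀ hx, sup_le_iff]
    constructor
    · rintro _ ⟨u, rfl⟩
      exact ⟨(u, 0), by simp [S]⟩
    · rintro _ ⟨c, rfl⟩
      exact ⟨(0, c), by simp [S]⟩
  obtain ⟨g, hg⟩ := (S x₀ : (E × (Fin n → 𝕜)) →ₗ[𝕜] F).exists_rightInverse_of_surjective hSurj
  -- A bounded right inverse of `S x₀`: the quasi-inverse handles the image of `L x₀`. On its
  -- finite-dimensional complement any linear right inverse `g` is automatically continuous.
  let ρ : F →L[𝕜] (E × (Fin n → 𝕜)) :=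
    ContinuousLinearMap.inl 𝕜 E (Fin n → 𝕜) ∘L pkg.quasiInverse +
      LinearMap.toContinuousLinearMap (g ∘ₗ pkg.decCodom.X₀.subtype) ∘L
        pkg.decCodom.X₀.projectionOntoL pkg.decCodom.X₁ pkg.decCodom.isTopCompl.symm
  have hρ : S x₀ ∘L ρ = 1 := by
    ext y
    have h1 : ∀ z, S x₀ (g z) = z := fun z => congrArg (fun T : F →ₗ[𝕜] F => T z) hg
    have h2 : ∀ u, L x₀ u = (pkg.equiv (pkg.decDom.proj u) : F) := fun u =>
      congrArg (fun T : E →L[𝕜] F => T u) pkg.eq_equiv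
    have h3 : L x₀ (pkg.quasiInverse y) = (pkg.decCodom.proj y : F) := by
      rw [h2]
      simp [ContinuousLinearMap.FredholmPackage.quasiInverse]
    have h4 : S x₀ (pkg.quasiInverse y, 0) = (pkg.decCodom.proj y : F) := by
      simp [S, h3]
    have h5 : (pkg.decCodom.proj y : F) + (pkg.decCodom.X₀.projectionOntoL pkg.decCodom.X₁
        pkg.decCodom.isTopCompl.symm y : F) = y :=
      Submodule.projection_add_projection_eq_self pkg.decCodom.isTopCompl.isCompl y
    show S x₀ ((pkg.quasiInverse y, 0) + g (pkg.decCodom.X₀.projectionOntoL pkg.decCodom.X₁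
        pkg.decCodom.isTopCompl.symm y : F)) = y
    rw [map_add, h1, h4, h5]
  obtain ⟨U, hU, hUO, hc, hu⟩ := exists_nhds_ringInverse (T := fun x => S x ∘L ρ)
    (hO.mem_nhds hx) (by fun_prop) hρ
  refine ⟨U, hU, fun x => ContinuousLinearMap.fst 𝕜 E (Fin n → 𝕜) ∘L ρ ∘L
    Ring.inverse (S x ∘L ρ), by fun_prop, fun x hx y => ?_⟩
  have h1 : S x (ρ (Ring.inverse (S x ∘L ρ) y)) = y :=
    congrArg (fun T : F →L[𝕜] F => T y) (Ring.mul_inverse_cancel _ (hu x hx))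
  rw [← hran x (hUO hx)]
  -- The right inverse of `S x` solves `L x (R y) + frame(c) = y`, so the error `L x (R y) - y` is
  -- `-frame(c)`.
  refine ⟨-(ρ (Ring.inverse (S x ∘L ρ) y)).2, ?_⟩
  nth_rw 3 [← h1]
  simp [S]

/-- Over a compact space, a family of Fredholm operators has a continuous right inverse modulo any
transversal subbundle. -/
theorem exists_rightInverse_mod [CompactSpace X] [T2Space X] [CompleteSpace F]
    (L : C(X, E →L[𝕜] F)) (hL : ∀ x, (L x).IsFredholm) (V : FinSubbundle 𝕜 X F)
    (hV : IsTransversal L V) : ∃ R : C(X, F →L[𝕜] E), ∀ x y, L x (R x y) - y ∈ V.fiber x := by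
  -- The condition on `R` is affine: when `c + d = 1`, the errors combine with the same coefficients
  -- inside the fibre of `V`.
  refine exists_continuous_section_of_local (𝕜 := 𝕜)
    (fun x => {R : F →L[𝕜] E | ∀ y, L x (R y) - y ∈ V.fiber x}) ?_
    (exists_local_rightInverse_mod L hL V hV)
  intro x a ha b hb c d hcd y
  have := (V.fiber x).add_mem ((V.fiber x).smul_mem c (ha y)) ((V.fiber x).smul_mem d (hb y))
  convert this using 1
  have hy : y = c • y + d • y := by rw [← add_smul, hcd, one_smul]
  nth_rw 2 [hy]
  simp [smul_sub]
  abel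

end Parametrices

/-! ### The fibrewise exchange isomorphism -/

section Exchange

variable {𝕜 : Type w} [RCLike 𝕜] {E F : Type v}
  [NormedAddCommGroup E] [NormedSpace 𝕜 E] [NormedAddCommGroup F] [NormedSpace 𝕜 F]

/-- For right inverses `R₁`, `R₂` of `T` modulo `V₁`, `V₂`, the map
`(u, b) ↦ (w - R₂ a, a)` with `w = u + R₁ b` and `a = T w - b`. -/
def exchangeMap (T : E →L[𝕜] F) (V₁ V₂ : Submodule 𝕜 F) {R₁ R₂ : F →L[𝕜] E}
    (h₁ : ∀ y, T (R₁ y) - y ∈ V₁) (h₂ : ∀ y, T (R₂ y) - y ∈ V₂) :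
    (V₁.comap (T : E →ₗ[𝕜] F) × V₂) →ₗ[𝕜] (V₂.comap (T : E →ₗ[𝕜] F) × V₁) where
  toFun p :=
    (⟨(p.1 + R₁ p.2) - R₂ (T (p.1 + R₁ p.2) - p.2), by
      show T ((p.1 + R₁ p.2) - R₂ (T (p.1 + R₁ p.2) - p.2)) ∈ V₂
      have := V₂.sub_mem p.2.2 (h₂ (T (p.1 + R₁ p.2) - p.2))
      convert this using 1
      rw [map_sub]
      abel⟩,
    ⟨T (p.1 + R₁ p.2) - p.2, by
      have := V₁.add_mem p.1.2 (h₁ p.2)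
      convert this using 1
      rw [map_add, ContinuousLinearMap.coe_coe]
      abel⟩)
  map_add' p q := by
    ext
    · simp
      abel
    · simp
      abel
  map_smul' c p := by
    ext
    · simp [smul_sub, smul_add]
    · simp [smul_sub, smul_add]

/-- Source and target both parametrize the triples `(w, a, b)` with `T w = a + b`. The reversed map
recovers `w` as `(w - R₂ a) + R₂ a`, then `b = T w - a`, and finally `u = w - R₁ b`. -/
theorem exchangeMap_exchangeMap (T : E →L[𝕜] F) (V₁ V₂ : Submodule 𝕜 F) {R₁ R₂ : F →L[𝕜] E}
    (h₁ : ∀ y, T (R₁ y) - y ∈ V₁) (h₂ : ∀ y, T (R₂ y) - y ∈ V₂)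
    (p : V₁.comap (T : E →ₗ[𝕜] F) × V₂) :
    exchangeMap T V₂ V₁ h₂ h₁ (exchangeMap T V₁ V₂ h₁ h₂ p) = p := by
  ext
  · simp [exchangeMap]
  · simp [exchangeMap]

/-- `T⁻¹(V₁) × V₂ ≃ T⁻¹(V₂) × V₁` if `T` has right inverses modulo `V₁` and modulo `V₂`. -/
def exchangeEquiv (T : E →L[𝕜] F) (V₁ V₂ : Submodule 𝕜 F) {R₁ R₂ : F →L[𝕜] E}
    (h₁ : ∀ y, T (R₁ y) - y ∈ V₁) (h₂ : ∀ y, T (R₂ y) - y ∈ V₂) :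
    (V₁.comap (T : E →ₗ[𝕜] F) × V₂) ≃ₗ[𝕜] (V₂.comap (T : E →ₗ[𝕜] F) × V₁) where
  __ := exchangeMap T V₁ V₂ h₁ h₂
  invFun := exchangeMap T V₂ V₁ h₂ h₁
  left_inv := exchangeMap_exchangeMap T V₁ V₂ h₁ h₂
  right_inv := exchangeMap_exchangeMap T V₂ V₁ h₂ h₁

end Exchange

/-! ### Continuity into and out of total spaces of subbundles -/

section Total

variable {𝕜 : Type w} [RCLike 𝕜] {X : Type u} [TopologicalSpace X] {F : Type v}
  [NormedAddCommGroup F] [NormedSpace 𝕜 F]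

theorem FinSubbundle.continuous_base_vec (V : FinSubbundle 𝕜 X F) :
    Continuous fun p : Total V.toVectBundle.fiber => (p.base, (V.fiber p.base).subtype p.vec) :=
  continuous_induced_dom

theorem FinSubbundle.continuous_mk {Y : Type*} [TopologicalSpace Y] {V : FinSubbundle 𝕜 X F}
    {f : Y → Total V.toVectBundle.fiber} (h₁ : Continuous fun y => (f y).base)
    (h₂ : Continuous fun y => (V.fiber (f y).base).subtype (f y).vec) : Continuous f :=
  continuous_induced_rng.2 (h₁.prodMk h₂)

end Total

/-! ### Independence of the transversal subbundle -/

section Fredholm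

variable {𝕜 : Type w} [RCLike 𝕜] {X : Type u} [TopologicalSpace X] {E F : Type v}
  [NormedAddCommGroup E] [NormedSpace 𝕜 E] [CompleteSpace E]
  [NormedAddCommGroup F] [NormedSpace 𝕜 F] [CompleteSpace F]

/-- The total spaces carry topologies induced from `X × E` and `X × F`, so it suffices that `w` and
`a` (`hw` and `ha` below) depend continuously on the point, by joint continuity of operator
evaluation. -/
theorem continuous_exchangeMap (L : C(X, E →L[𝕜] F)) (hL : ∀ x, (L x).IsFredholm)
    (V₁ V₂ : FinSubbundle 𝕜 X F) (hV₁ : IsTransversal L V₁) (hV₂ : IsTransversal L V₂)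
    (R₁ R₂ : C(X, F →L[𝕜] E)) (h₁ : ∀ x y, L x (R₁ x y) - y ∈ V₁.fiber x)
    (h₂ : ∀ x y, L x (R₂ x y) - y ∈ V₂.fiber x) :
    Continuous fun p : Total
        (sum (preimageBundle L hL V₁ hV₁).toVectBundle V₂.toVectBundle).fiber =>
      (⟨p.base, exchangeMap (L p.base) (V₁.fiber p.base) (V₂.fiber p.base) (h₁ p.base) (h₂ p.base)
        p.vec⟩ : Total (sum (preimageBundle L hL V₂ hV₂).toVectBundle V₁.toVectBundle).fiber) := by
  have hu := (FinSubbundle.continuous_base_vec _).comp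
    (continuous_sum_fst (preimageBundle L hL V₁ hV₁).toVectBundle V₂.toVectBundle)
  have hv := (FinSubbundle.continuous_base_vec _).comp
    (continuous_sum_snd (preimageBundle L hL V₁ hV₁).toVectBundle V₂.toVectBundle)
  have hb := continuous_fst.comp hu
  have hw := (continuous_snd.comp hu).add
    ((R₁.continuous.comp hb).clm_apply (continuous_snd.comp hv))
  have ha := ((L.continuous.comp hb).clm_apply hw).sub (continuous_snd.comp hv)
  exact continuous_sum_mk
    (FinSubbundle.continuous_mk hb (hw.sub ((R₂.continuous.comp hb).clm_apply ha)))
    (FinSubbundle.continuous_mk hb ha)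

/-- `E(L, V₁) ⊕ V₂ ≅ E(L, V₂) ⊕ V₁` for subbundles `V₁`, `V₂` transversal to the image of `L`. -/
theorem nonempty_exchangeIso [CompactSpace X] [T2Space X] (L : C(X, E →L[𝕜] F))
    (hL : ∀ x, (L x).IsFredholm) (V₁ V₂ : FinSubbundle 𝕜 X F) (hV₁ : IsTransversal L V₁)
    (hV₂ : IsTransversal L V₂) :
    Nonempty (Iso (sum (preimageBundle L hL V₁ hV₁).toVectBundle V₂.toVectBundle)
      (sum (preimageBundle L hL V₂ hV₂).toVectBundle V₁.toVectBundle)) := by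
  obtain ⟨R₁, h₁⟩ := exists_rightInverse_mod L hL V₁ hV₁
  obtain ⟨R₂, h₂⟩ := exists_rightInverse_mod L hL V₂ hV₂
  exact ⟨{
    equiv := fun x => exchangeEquiv (L x) (V₁.fiber x) (V₂.fiber x) (h₁ x) (h₂ x)
    continuous_toFun := continuous_exchangeMap L hL V₁ V₂ hV₁ hV₂ R₁ R₂ h₁ h₂
    continuous_invFun := continuous_exchangeMap L hL V₂ V₁ hV₂ hV₁ R₂ R₁ h₂ h₁ }⟩

theorem kClass_sum (A B : VectBundle.{u, v, w} 𝕜 X) : kClass (sum A B) = kClass A + kClass B := by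
  let a : IsoClass.{u, v, w} 𝕜 X := Quotient.mk (isoSetoid 𝕜 X) A
  let b : IsoClass.{u, v, w} 𝕜 X := Quotient.mk (isoSetoid 𝕜 X) B
  exact map_add Algebra.GrothendieckAddGroup.of a b

theorem kClass_eq_of_iso {A B : VectBundle.{u, v, w} 𝕜 X} (f : Iso A B) : kClass A = kClass B :=
  congrArg Algebra.GrothendieckAddGroup.of (Quotient.sound ⟨f⟩)

/-- `[E(L, V)] - [V]` does not depend on the transversal subbundle `V`. -/
theorem kClass_preimageBundle_sub [CompactSpace X] [T2Space X] (L : C(X, E →L[𝕜] F))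
    (hL : ∀ x, (L x).IsFredholm) (V₁ V₂ : FinSubbundle 𝕜 X F) (hV₁ : IsTransversal L V₁)
    (hV₂ : IsTransversal L V₂) :
    kClass (preimageBundle L hL V₁ hV₁).toVectBundle - kClass V₁.toVectBundle =
      kClass (preimageBundle L hL V₂ hV₂).toVectBundle - kClass V₂.toVectBundle := by
  obtain ⟨f⟩ := nonempty_exchangeIso L hL V₁ V₂ hV₁ hV₂
  rw [sub_eq_sub_iff_add_eq_add, ← kClass_sum, ← kClass_sum]
  exact kClass_eq_of_iso f

/-- `V` itself excludes the default value `0` in the definition, and independence replaces the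
chosen subbundle by `V`. -/
theorem indexBundle_eq [CompactSpace X] [T2Space X] (L : C(X, E →L[𝕜] F))
    (hL : ∀ x, (L x).IsFredholm) (V : FinSubbundle 𝕜 X F) (hV : IsTransversal L V) :
    indexBundle L hL =
      kClass (preimageBundle L hL V hV).toVectBundle - kClass V.toVectBundle := by
  have h : ∃ V : FinSubbundle 𝕜 X F, IsTransversal L V := ⟨V, hV⟩
  rw [indexBundle, dif_pos h]
  exact kClass_preimageBundle_sub L hL _ _ _ _

end Fredholm

/-! ### Classical data and comparison of the two index bundles -/

section Classical

variable {𝕜 : Type w} [RCLike 𝕜] {X : Type u} [TopologicalSpace X] {E : Type v}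
  [NormedAddCommGroup E] [NormedSpace 𝕜 E] {L : C(X, E →L[𝕜] E)}

/-- With `A` a left inverse of `L` on `M` and values in `M`, the product `P = L A` satisfies `L A L
A = L A`. Its image is `L(M)` because `A x` maps onto `M`. -/
theorem nonempty_classicalData [CompactSpace X] [T2Space X] [CompleteSpace E]
    (hL : ∀ x, (L x).IsFredholm) : Nonempty (ClassicalData L) := by
  obtain ⟨M, hMcl, hMfin, A, hAM, hA⟩ := exists_leftInverse L hL
  refine ⟨{
    E₁ := M
    isClosed := hMcl
    finite_codim := hMfin
    ker_inf := fun x => ?_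
    P := ⟨fun x => L x ∘L A x, by have := L.continuous; have := A.continuous; fun_prop⟩
    idem := fun x => ?_
    range_eq := fun x => ?_ }⟩
  · rw [eq_bot_iff]
    rintro u ⟨hu, huM⟩
    have hu' : L x u = 0 := hu
    have := hA x u huM
    rw [hu', map_zero] at this
    exact this.symm
  · ext y
    exact congrArg (L x) (hA x _ (hAM x y))
  · apply le_antisymm
    · rintro _ ⟨y, rfl⟩
      exact ⟨A x y, hAM x y, rfl⟩
    · rintro _ ⟨u, hu, rfl⟩
      exact ⟨L x u, congrArg (L x) (hA x u hu)⟩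

namespace ClassicalData

variable (D : ClassicalData L)

theorem exists_P_apply (x : X) (y : E) : ∃ u ∈ D.E₁, L x u = D.P x y := by
  have : D.P x y ∈ (D.P x).range := ⟨y, rfl⟩
  rw [D.range_eq] at this
  exact this

theorem P_map (x : X) {u : E} (hu : u ∈ D.E₁) : D.P x (L x u) = L x u := by
  have : L x u ∈ (D.P x).range := by
    rw [D.range_eq]
    exact ⟨u, hu, rfl⟩
  obtain ⟨a, ha⟩ := this
  rw [← show D.P x a = L x u from ha]
  exact congrArg (fun T : E →L[𝕜] E => T a) (D.idem x)

theorem continuous_quotientBundle_base_vec :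
    Continuous fun p : Total D.quotientBundle.fiber =>
      ((p.base, (p.vec : E ⧸ D.E₁)) : X × (E ⧸ D.E₁)) :=
  continuous_induced_dom

variable [CompleteSpace E]

/-- In `y = P y + (1 - P) y`, the first summand lies in `L(E₁)` and the second in `W`. -/
theorem isTransversal_W (hL : ∀ x, (L x).IsFredholm) : IsTransversal L (D.W hL) := by
  intro x
  rw [eq_top_iff]
  intro y _
  obtain ⟨u, -, hu⟩ := D.exists_P_apply x y
  refine Submodule.mem_sup.2 ⟨_, ⟨u, rfl⟩, _, ⟨y, rfl⟩, ?_⟩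
  show L x u + (y - D.P x y) = y
  rw [hu]
  abel

theorem mem_W_iff (hL : ∀ x, (L x).IsFredholm) (x : X) (y : E) :
    y ∈ (D.W hL).fiber x ↔ D.P x y = 0 := by
  constructor
  · rintro ⟨a, rfl⟩
    have : D.P x (D.P x a) = D.P x a := congrArg (fun T : E →L[𝕜] E => T a) (D.idem x)
    show D.P x (a - D.P x a) = 0
    rw [map_sub, this, sub_self]
  · intro h
    refine ⟨y, ?_⟩
    show y - D.P x y = y
    rw [h, sub_zero]

/-- The fibre is `ker (P L)`. It meets `E₁` trivially because `P L = L` is injective there. For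
surjectivity, any `u` is corrected by some `e ∈ E₁` with `L e = P L u`, which leaves its class
modulo `E₁` unchanged. -/
theorem bijective_mkQ (hL : ∀ x, (L x).IsFredholm) (x : X) :
    Function.Bijective (D.E₁.mkQ ∘ₗ ((preimageBundle L hL (D.W hL) (D.isTransversal_W hL)).fiber
      x).subtype) := by
  constructor
  · rw [injective_iff_map_eq_zero]
    rintro ⟨u, hu⟩ h
    have hu₁ : u ∈ D.E₁ := (Submodule.Quotient.mk_eq_zero _).1 h
    have hu₀ : L x u = 0 := by rw [← D.P_map x hu₁]; exact (D.mem_W_iff hL x _).1 hu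
    have : u ∈ (L x).ker ⊓ D.E₁ := ⟨hu₀, hu₁⟩
    rw [D.ker_inf x] at this
    exact Subtype.ext this
  · intro q
    obtain ⟨u, rfl⟩ := D.E₁.mkQ_surjective q
    obtain ⟨e, he, heu⟩ := D.exists_P_apply x (L x u)
    refine ⟨⟨u - e, (D.mem_W_iff hL x _).2 ?_⟩, ?_⟩
    · show D.P x (L x (u - e)) = 0
      rw [map_sub, map_sub, D.P_map x he, heu, sub_self]
    · show D.E₁.mkQ (u - e) = D.E₁.mkQ u
      rw [map_sub, sub_eq_self]
      exact (Submodule.Quotient.mk_eq_zero _).2 he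

/-- The isomorphism `E(L, W) ≅ Θ(E/E₁)`. -/
noncomputable def preimageIso (hL : ∀ x, (L x).IsFredholm) :
    Iso (preimageBundle L hL (D.W hL) (D.isTransversal_W hL)).toVectBundle D.quotientBundle where
  equiv x := LinearEquiv.ofBijective _ (D.bijective_mkQ hL x)
  continuous_toFun := by
    have h := FinSubbundle.continuous_base_vec
      (preimageBundle L hL (D.W hL) (D.isTransversal_W hL))
    exact continuous_induced_rng.2 ((continuous_fst.comp h).prodMk
      (D.E₁.mkQL.continuous.comp (continuous_snd.comp h)))
  continuous_invFun := by
    have := D.isClosed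
    let B := preimageBundle L hL (D.W hL) (D.isTransversal_W hL)
    have h := D.continuous_quotientBundle_base_vec
    have hb := continuous_fst.comp h
    have hq := continuous_snd.comp h
    refine FinSubbundle.continuous_mk hb (continuous_iff_continuousAt.2 fun p₀ => ?_)
    obtain ⟨U, n, s, hU, hx, hs, hsp⟩ := B.locally_framed p₀.base
    let e : ∀ x, B.fiber x ≃ₗ[𝕜] (E ⧸ D.E₁) := fun x =>
      LinearEquiv.ofBijective _ (D.bijective_mkQ hL x)
    have hex : ∀ p : Total D.quotientBundle.fiber, ∃ c : Fin n → 𝕜, p.base ∈ U →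
        frameMap (fun i => s i p.base) c = (((e p.base).symm p.vec : B.fiber p.base) : E) := by
      intro p
      by_cases hp : p.base ∈ U
      · have h1 := ((e p.base).symm p.vec).2
        obtain ⟨c, hc⟩ := (((frameMap_range _).trans (hsp p.base hp).2).ge h1)
        exact ⟨c, fun _ => hc⟩
      · exact ⟨0, fun h => absurd h hp⟩
    choose c hc using hex
    have hUp : ∀ᶠ p : Total D.quotientBundle.fiber in 𝓝 p₀, p.base ∈ U :=
      hb.continuousAt.eventually (hU.mem_nhds hx)
    have hS : ContinuousAt (fun p : Total D.quotientBundle.fiber =>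
        (frameMap (fun i => s i p.base) : (Fin n → 𝕜) →L[𝕜] E)) p₀ :=
      ContinuousAt.comp (f := fun p : Total D.quotientBundle.fiber => p.base)
        ((frameMap_continuousOn hs).continuousAt (hU.mem_nhds hx)) hb.continuousAt
    -- Projecting the frame to `E ⧸ E₁` keeps it injective at `p₀`, since the quotient map is
    -- injective on the fibre. There the combination with coefficients `c` is the given vector
    -- `p.vec`, which is continuous, so `continuousAt_coord` applies without knowing continuity of
    -- the inverse.
    have hcc : ContinuousAt c p₀ := by
      refine continuousAt_coord (S := fun p : Total D.quotientBundle.fiber =>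
        D.E₁.mkQL ∘L (frameMap (fun i => s i p.base) : (Fin n → 𝕜) →L[𝕜] E)) ?_ ?_ ?_
      · exact continuousAt_const.clm_comp hS
      · intro a b hab
        have hmem : ∀ a : Fin n → 𝕜, frameMap (fun i => s i p₀.base) a ∈ B.fiber p₀.base := by
          intro a
          rw [← (hsp p₀.base hx).2, ← frameMap_range]
          exact ⟨a, rfl⟩
        have h1 : e p₀.base ⟨_, hmem a⟩ = e p₀.base ⟨_, hmem b⟩ := hab
        exact frameMap_injective (hsp p₀.base hx).1
          (congrArg Subtype.val ((e p₀.base).injective h1))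
      · refine hq.continuousAt.congr ?_
        filter_upwards [hUp] with p hp
        show p.vec = D.E₁.mkQ (frameMap (fun i => s i p.base) (c p))
        rw [hc p hp]
        exact ((e p.base).apply_symm_apply p.vec).symm
    refine (hS.clm_apply hcc).congr ?_
    filter_upwards [hUp] with p hp
    exact hc p hp

theorem indexBundle_eq_index [CompactSpace X] [T2Space X] (hL : ∀ x, (L x).IsFredholm) :
    indexBundle L hL = D.index hL := by
  rw [indexBundle_eq L hL (D.W hL) (D.isTransversal_W hL), index,
    kClass_eq_of_iso (D.preimageIso hL)]

end ClassicalData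

end Classical

end IndexBundle

theorem mainTheorem12 {𝕜 : Type*} [RCLike 𝕜] {X : Type*} [TopologicalSpace X] [CompactSpace X]
    [T2Space X] {E : Type*} [NormedAddCommGroup E] [NormedSpace 𝕜 E] [CompleteSpace E]
    (L : C(X, E →L[𝕜] E)) (hL : ∀ x, (L x).IsFredholm) :
    (∀ (V : IndexBundle.FinSubbundle 𝕜 X E) (hV : IndexBundle.IsTransversal L V),
      IndexBundle.indexBundle L hL =
        IndexBundle.kClass (IndexBundle.preimageBundle L hL V hV).toVectBundle
          - IndexBundle.kClass V.toVectBundle) ∧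
    Nonempty (IndexBundle.ClassicalData L) ∧
    ∀ D : IndexBundle.ClassicalData L, ∃ hW : IndexBundle.IsTransversal L (D.W hL),
      (∃ Φ : IndexBundle.VectBundle.Iso
          (IndexBundle.preimageBundle L hL (D.W hL) hW).toVectBundle D.quotientBundle,
        ∀ (x : X) (u : (IndexBundle.preimageBundle L hL (D.W hL) hW).fiber x),
          Φ.equiv x u = D.E₁.mkQ (u : E)) ∧
      IndexBundle.indexBundle L hL = D.index hL := by
  exact ⟨IndexBundle.indexBundle_eq L hL, IndexBundle.nonempty_classicalData hL, fun D =>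
    ⟨D.isTransversal_W hL, ⟨D.preimageIso hL, fun _ _ => rfl⟩, D.indexBundle_eq_index hL⟩⟩
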